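/- Let $p\in(1,\infty)$ and $1<q\le r<\infty$, and put $p'=\frac{p}{p-1}$. For finite exponents $a,b>0$ let $L^{a,b}(0,\infty)$ be the Lorentz space of (a.e. classes of) measurable functions $f:(0,\infty)\to\mathbb{R}$ with $$\|f\|_{a,b}=a^{1/b}\Bigl(\int_0^\infty t^{b-1}\,\bigl|\{x>0:|f(x)|>t\}\bigr|^{b/a}\,dt\Bigr)^{1/b}<\infty,$$ where $|\cdot|$ of a set denotes Lebesgue measure. Then the Laplace transform $$Lf(t)=\int_0^\infty f(s)e^{-ts}\,ds,\qquad t\in(0,\infty),$$ is a well-defined (the integral converges absolutely for every $f\in L^{p,q}(0,\infty)$ and every $t>0$) bounded operator $L:L^{p,q}(0,\infty)\to L^{p',r}(0,\infty)$, and it is maximally non-compact, that is, $\alpha(L)=\|L\|$. Here $\|L\|=\sup\{\|Lf\|_{p',r}:\|f\|_{p,q}\le 1\}$, and the ball measure of non-compactness $\alpha(L)$ is the infimum of all $\rho>0$ for which $L(\{f:\|f\|_{p,q}\le1\})$ can be covered by finitely many balls $\{g:\|g-h\|_{p',r}\le\rho\}$ with centres $h\in L^{p',r}(0,\infty)$.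 -/

import Mathlib

open MeasureTheory Set
open scoped ENNReal

noncomputable section

/-- The Lorentz functional
`‖f‖_{p,r} = p^{1/r} (∫₀^∞ t^{r-1} μ{x : |f x| > t}^{r/p} dt)^{1/r}`
for finite exponents `p, r`, with values in `[0,∞]`. -/
def eLorentzNorm {α : Type*} [MeasurableSpace α] (f : α → ℝ) (p r : ℝ) (μ : Measure α) : ℝ≥0∞ :=
  ENNReal.ofReal p ^ (1 / r) *
    (∫⁻ t in Ioi (0 : ℝ), ENNReal.ofReal (t ^ (r - 1)) * μ {x | t < |f x|} ^ (r / p)) ^ (1 / r)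

/-- `f` represents an element of the Lorentz space `L^{p,r}(μ)`. -/
def MemLorentz {α : Type*} [MeasurableSpace α] (f : α → ℝ) (p r : ℝ) (μ : Measure α) : Prop :=
  AEStronglyMeasurable f μ ∧ eLorentzNorm f p r μ < ∞

/-- The operator norm of `T : L^{p,q}(μ) → L^{s,r}(ν)`: the supremum of `‖T f‖_{s,r}` over the
closed unit ball of `L^{p,q}(μ)`. -/
def lorentzOpNorm {α β : Type*} [MeasurableSpace α] [MeasurableSpace β]
    (T : (α → ℝ) → β → ℝ) (p q : ℝ) (μ : Measure α) (s r : ℝ) (ν : Measure β) : ℝ≥0∞ :=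
  ⨆ (f : α → ℝ) (_ : MemLorentz f p q μ) (_ : eLorentzNorm f p q μ ≤ 1), eLorentzNorm (T f) s r ν

/-- The ball measure of non-compactness of `T : L^{p,q}(μ) → L^{s,r}(ν)`: the infimum of all radii
`ρ > 0` such that finitely many balls of radius `ρ`, centred at elements of `L^{s,r}(ν)`, cover the
image of the closed unit ball of `L^{p,q}(μ)`. -/
def lorentzBallMeasure {α β : Type*} [MeasurableSpace α] [MeasurableSpace β]
    (T : (α → ℝ) → β → ℝ) (p q : ℝ) (μ : Measure α) (s r : ℝ) (ν : Measure β) : ℝ≥0∞ :=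
  sInf {ρ : ℝ≥0∞ | 0 < ρ ∧ ρ < ∞ ∧ ∃ C : Set (β → ℝ), C.Finite ∧ (∀ h ∈ C, MemLorentz h s r ν) ∧
    ∀ f : α → ℝ, MemLorentz f p q μ → eLorentzNorm f p q μ ≤ 1 →
      ∃ h ∈ C, eLorentzNorm (T f - h) s r ν ≤ ρ}

/-- Lebesgue measure on the half-line `(0,∞)`. -/
def halfLine : Measure ℝ := volume.restrict (Ioi 0)

/-- The Laplace transform `L f (t) = ∫₀^∞ f(s) e^{-ts} ds`. -/
def laplaceTransform (f : ℝ → ℝ) (t : ℝ) : ℝ :=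
  ∫ s, f s * Real.exp (-(t * s)) ∂halfLine

end

/-! The argument has two independent halves.

Boundedness. Let `f*` be the nonincreasing rearrangement, realised here as the generalised inverse
of the distribution function. Since `e^{-ts} ≤ 1` and `∫ e^{-ts} ds = 1/t`, one has `|Lf(t)| ≤
∫₀^{1/t} f*` (`lintegral_laplace_le`). The Lorentz functional is a power-weighted Lebesgue norm of
`f*` (`lintegral_rpow_mul_antitone`), so a Hardy inequality (`exists_hardy`) bounds `L` from
`L^{p,q}` to `L^{p',q}`, which embeds into `L^{p',r}` (`eLorentzNorm_le_of_le`).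

Maximal non-compactness. The dilations `D_k f = k^{1/p} f(k ·)` are isometries of `L^{p,q}`, and `L`
intertwines them with the inverse dilations `D'_{1/k}` of `L^{p',r}`. If finitely many balls of
radius `ρ` cover the image of the unit ball, testing on `D_k f` and undoing the dilation gives `‖Lf
- D'_k h‖ ≤ ρ` for some centre `h` depending on `k`. By pigeonhole one `h` serves infinitely many
integers `k`. Along these `D'_k h → 0` in measure (`tendsto_distribution_lorentzDilation`), and the
Fatou property (`eLorentzNorm_le_of_tendsto_distribution`) yields `‖Lf‖ ≤ ρ`. Hence `‖L‖ ≤ α(L)`;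
the reverse inequality is trivial. -/

/-! ### Power integrals and generalised inverses on the half-line -/

instance : SFinite halfLine := by unfold halfLine; infer_instance

lemma ae_halfLine_pos : ∀ᵐ x ∂halfLine, 0 < x := ae_restrict_mem measurableSet_Ioi

lemma halfLine_restrict_ofReal_lt (x : ℝ) :
    halfLine.restrict {s | ENNReal.ofReal s < ENNReal.ofReal x} = volume.restrict (Ioo 0 x) := by
  rw [halfLine, Measure.restrict_restrict
    (measurableSet_lt ENNReal.measurable_ofReal measurable_const)]
  congr 1
  ext s
  simp only [mem_inter_iff, mem_ofPred_eq, mem_Ioi, mem_Ioo]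
  constructor
  · rintro ⟨h, hs⟩
    exact ⟨hs, (ENNReal.ofReal_lt_ofReal_iff_of_nonneg hs.le).1 h⟩
  · rintro ⟨hs, h⟩
    exact ⟨(ENNReal.ofReal_lt_ofReal_iff_of_nonneg hs.le).2 h, hs⟩

lemma setLIntegral_Ioo_rpow {c x : ℝ} (hc : 0 < c) (hx : 0 ≤ x) :
    ∫⁻ s in Ioo 0 x, ENNReal.ofReal (s ^ (c - 1)) = ENNReal.ofReal x ^ c / ENNReal.ofReal c := by
  rw [ENNReal.ofReal_rpow_of_nonneg hx hc.le, ← ENNReal.ofReal_div_of_pos hc,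
    setLIntegral_congr Ioo_ae_eq_Ioc, ← ofReal_integral_eq_lintegral_ofReal,
    ← intervalIntegral.integral_of_le hx, integral_rpow (Or.inl (by linarith))]
  · simp [hc.ne']
  · exact (intervalIntegrable_iff_integrableOn_Ioc_of_le hx).1
      (intervalIntegral.intervalIntegrable_rpow' (by linarith))
  · filter_upwards [ae_restrict_mem measurableSet_Ioc] with s hs
    exact Real.rpow_nonneg hs.1.le _

lemma setLIntegral_halfLine_rpow {c : ℝ} (hc : 0 < c) (D : ℝ≥0∞) :
    ∫⁻ s in {s | ENNReal.ofReal s < D}, ENNReal.ofReal (s ^ (c - 1)) ∂halfLine =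
      D ^ c / ENNReal.ofReal c := by
  have key : ∀ x : ℝ, 0 ≤ x →
      ∫⁻ s in {s | ENNReal.ofReal s < ENNReal.ofReal x}, ENNReal.ofReal (s ^ (c - 1)) ∂halfLine =
        ENNReal.ofReal x ^ c / ENNReal.ofReal c := fun x hx => by
    rw [halfLine_restrict_ofReal_lt, setLIntegral_Ioo_rpow hc hx]
  by_cases hD : D = ∞
  · subst hD
    rw [ENNReal.top_rpow_of_pos hc, ENNReal.top_div_of_ne_top ENNReal.ofReal_ne_top]
    refine ENNReal.eq_top_of_forall_nnreal_le fun y => ?_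
    -- The endpoint `x = (c y)^{1/c}` solves `x^c / c = y`, so the integral over the whole half-line
    -- is at least every finite `y`.
    have h := key ((c * y) ^ c⁻¹) (by positivity)
    have h2 : ENNReal.ofReal ((c * y) ^ c⁻¹) ^ c / ENNReal.ofReal c = y := by
      rw [ENNReal.ofReal_rpow_of_nonneg (by positivity) hc.le, Real.rpow_inv_rpow (by positivity)
        hc.ne', ← ENNReal.ofReal_div_of_pos hc, mul_div_cancel_left₀ _ hc.ne']
      simp
    rw [← h2, ← h]
    exact lintegral_mono_set fun s _ => ENNReal.ofReal_lt_top
  · simpa [ENNReal.ofReal_toReal hD] using key D.toReal ENNReal.toReal_nonneg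

lemma halfLine_ofReal_lt (D : ℝ≥0∞) : halfLine {s | ENNReal.ofReal s < D} = D := by
  simpa using setLIntegral_halfLine_rpow one_pos D

/-- A down-closed subset of the half-line is an initial interval, up to an endpoint. -/
lemma setLIntegral_halfLine_rpow_of_isLowerSet {c : ℝ} (hc : 0 < c) {A : Set ℝ}
    (hA : IsLowerSet A) :
    ∫⁻ s in A, ENNReal.ofReal (s ^ (c - 1)) ∂halfLine = halfLine A ^ c / ENNReal.ofReal c := by
  have : A =ᵐ[halfLine] {s | ENNReal.ofReal s < halfLine A} := by
    have hle : ∀ s ∈ A, ENNReal.ofReal s ≤ halfLine A := fun s hs => by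
      conv_lhs => rw [← halfLine_ofReal_lt (ENNReal.ofReal s)]
      exact measure_mono fun u hu => hA (ENNReal.ofReal_lt_ofReal_iff'.1 hu).1.le hs
    have hge : ∀ s ∉ A, halfLine A ≤ ENNReal.ofReal s := fun s hs => by
      rw [← halfLine_ofReal_lt (ENNReal.ofReal s)]
      refine measure_mono_ae ?_
      filter_upwards [ae_halfLine_pos] with u hu huA
      have : u < s := not_le.1 fun h => hs (hA h huA)
      exact (ENNReal.ofReal_lt_ofReal_iff_of_nonneg hu.le).2 this
    have hne : ∀ᵐ s ∂halfLine, s ≠ (halfLine A).toReal :=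
      ae_restrict_of_ae (Measure.ae_ne volume _)
    filter_upwards [hne, ae_halfLine_pos] with s hs hs0
    refine propext ⟨fun h => lt_of_le_of_ne (hle s h) fun h' => hs ?_, fun h => ?_⟩
    · rw [← h', ENNReal.toReal_ofReal hs0.le]
    · by_contra h'
      exact absurd h (not_lt.2 (hge s h'))
  rw [setLIntegral_congr this, setLIntegral_halfLine_rpow hc]

/-- Fubini over the region below the graph of `d`. -/
lemma lintegral_halfLine_region_swap {d : ℝ → ℝ≥0∞} (hd : Measurable d) {g h : ℝ → ℝ≥0∞}
    (hg : Measurable g) (hh : Measurable h) :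
    ∫⁻ u, g u * ∫⁻ s in {s | ENNReal.ofReal s < d u}, h s ∂halfLine ∂halfLine =
      ∫⁻ s, h s * ∫⁻ u in {u | ENNReal.ofReal s < d u}, g u ∂halfLine ∂halfLine := by
  have hms : MeasurableSet {z : ℝ × ℝ | ENNReal.ofReal z.2 < d z.1} :=
    measurableSet_lt (by fun_prop) (by fun_prop)
  have h1 : ∀ u, g u * ∫⁻ s in {s | ENNReal.ofReal s < d u}, h s ∂halfLine =
      ∫⁻ s, {z : ℝ × ℝ | ENNReal.ofReal z.2 < d z.1}.indicator (fun z => g z.1 * h z.2) (u, s)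
        ∂halfLine := fun u => by
    rw [← lintegral_const_mul _ hh, ← lintegral_indicator
      (measurableSet_lt (by fun_prop) (by fun_prop))]
    rfl
  have h2 : ∀ s, h s * ∫⁻ u in {u | ENNReal.ofReal s < d u}, g u ∂halfLine =
      ∫⁻ u, {z : ℝ × ℝ | ENNReal.ofReal z.2 < d z.1}.indicator (fun z => g z.1 * h z.2) (u, s)
        ∂halfLine := fun s => by
    rw [← lintegral_const_mul _ hg, ← lintegral_indicator
      (measurableSet_lt (by fun_prop) (by fun_prop))]
    simp_rw [mul_comm (h s)]
    rfl
  simp_rw [h1, h2]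
  exact lintegral_lintegral_swap
    (((by fun_prop : Measurable fun z : ℝ × ℝ => g z.1 * h z.2).indicator hms).aemeasurable)

lemma antitone_halfLine_lt (d : ℝ → ℝ≥0∞) :
    Antitone fun s => halfLine {u | ENNReal.ofReal s < d u} := fun _ _ hst =>
  measure_mono fun _ hu => lt_of_le_of_lt (ENNReal.ofReal_le_ofReal hst) hu

/-- The Lorentz functional of a distribution function in terms of its generalised inverse. -/
lemma lintegral_rpow_mul_antitone {d : ℝ → ℝ≥0∞} (hd : Antitone d) {a b : ℝ} (ha : 0 < a)
    (hb : 0 < b) :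
    ENNReal.ofReal a * ∫⁻ u, ENNReal.ofReal (u ^ (b - 1)) * d u ^ (b / a) ∂halfLine =
      ∫⁻ s, ENNReal.ofReal (s ^ (b / a - 1)) *
        halfLine {u | ENNReal.ofReal s < d u} ^ b ∂halfLine := by
  have hba : 0 < b / a := div_pos hb ha
  -- Each power is written as an integral of a power over an initial interval; both sides then
  -- become `b` times the same double integral over the subgraph of `d`.
  have e1 : ∀ u, ENNReal.ofReal a * (ENNReal.ofReal (u ^ (b - 1)) * d u ^ (b / a)) =
      ENNReal.ofReal b * (ENNReal.ofReal (u ^ (b - 1)) *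
        ∫⁻ s in {s | ENNReal.ofReal s < d u}, ENNReal.ofReal (s ^ (b / a - 1)) ∂halfLine) := by
    intro u
    have : ENNReal.ofReal a = ENNReal.ofReal b * (ENNReal.ofReal (b / a))⁻¹ := by
      rw [← ENNReal.ofReal_inv_of_pos hba, ← ENNReal.ofReal_mul hb.le]
      congr 1
      field_simp
    rw [setLIntegral_halfLine_rpow hba, this, ENNReal.div_eq_inv_mul]
    generalize ENNReal.ofReal (b / a) = x, d u ^ (b / a) = y
    ring
  have e2 : ∀ s, ENNReal.ofReal (s ^ (b / a - 1)) * halfLine {u | ENNReal.ofReal s < d u} ^ b =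
      ENNReal.ofReal b * (ENNReal.ofReal (s ^ (b / a - 1)) *
        ∫⁻ u in {u | ENNReal.ofReal s < d u}, ENNReal.ofReal (u ^ (b - 1)) ∂halfLine) := by
    intro s
    have hlow : IsLowerSet {u | ENNReal.ofReal s < d u} := fun x y hyx hx =>
      lt_of_lt_of_le hx (hd hyx)
    rw [setLIntegral_halfLine_rpow_of_isLowerSet hb hlow,
      mul_left_comm, ENNReal.mul_div_cancel (by simpa using hb) ENNReal.ofReal_ne_top]
  rw [← lintegral_const_mul' _ _ ENNReal.ofReal_ne_top]
  simp_rw [e1, e2]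
  rw [lintegral_const_mul' _ _ ENNReal.ofReal_ne_top, lintegral_const_mul' _ _ ENNReal.ofReal_ne_top,
    lintegral_halfLine_region_swap hd.measurable (by fun_prop) (by fun_prop)]

/-! ### Distribution functions and the embedding in the second index -/

/-- The distribution function of `f`. -/
noncomputable def distribution {α : Type*} [MeasurableSpace α] (f : α → ℝ) (μ : Measure α) (t : ℝ) :
    ℝ≥0∞ := μ {x | t < |f x|}

lemma antitone_distribution {α : Type*} [MeasurableSpace α] (f : α → ℝ) (μ : Measure α) :
    Antitone (distribution f μ) := fun _ _ hst => measure_mono fun _ hx => lt_of_le_of_lt hst hx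

lemma measurable_rpow_mul_distribution {α : Type*} [MeasurableSpace α] (f : α → ℝ) (μ : Measure α)
    (a b : ℝ) : Measurable fun t : ℝ => ENNReal.ofReal (t ^ a) * distribution f μ t ^ b :=
  (by fun_prop : Measurable fun t : ℝ => ENNReal.ofReal (t ^ a)).mul
    ((antitone_distribution f μ).measurable.pow_const _)

lemma eLorentzNorm_rpow {α : Type*} [MeasurableSpace α] (f : α → ℝ) (p : ℝ) {r : ℝ} (hr : 0 < r)
    (μ : Measure α) :
    eLorentzNorm f p r μ ^ r = ENNReal.ofReal p *
      ∫⁻ t, ENNReal.ofReal (t ^ (r - 1)) * distribution f μ t ^ (r / p) ∂halfLine := by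
  rw [eLorentzNorm, ENNReal.mul_rpow_of_nonneg _ _ hr.le, ← ENNReal.rpow_mul, ← ENNReal.rpow_mul,
    one_div_mul_cancel hr.ne', ENNReal.rpow_one, ENNReal.rpow_one]
  rfl

lemma eLorentzNorm_zero {α : Type*} [MeasurableSpace α] (μ : Measure α) {p r : ℝ} (hp : 0 < p)
    (hr : 0 < r) : eLorentzNorm (0 : α → ℝ) p r μ = 0 := by
  have h : eLorentzNorm (0 : α → ℝ) p r μ ^ r = 0 := by
    rw [eLorentzNorm_rpow _ _ hr, mul_eq_zero, lintegral_eq_zero_iff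
      (measurable_rpow_mul_distribution _ _ _ _)]
    right
    filter_upwards [ae_halfLine_pos] with t ht
    simp [distribution, ht.not_gt, div_pos hr hp]
  exact (ENNReal.rpow_eq_zero_iff_of_pos hr).1 h

/-- Chebyshev's inequality in Lorentz spaces. -/
lemma rpow_mul_distribution_le {α : Type*} [MeasurableSpace α] (f : α → ℝ) (μ : Measure α)
    {p r t : ℝ} (hp : 0 < p) (hr : 0 < r) (ht : 0 < t) :
    ENNReal.ofReal t ^ r * distribution f μ t ^ (r / p) ≤ ENNReal.ofReal r *
      ∫⁻ u in Ioo 0 t, ENNReal.ofReal (u ^ (r - 1)) * distribution f μ u ^ (r / p) := by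
  have h : ∫⁻ u in Ioo 0 t, ENNReal.ofReal (u ^ (r - 1)) * distribution f μ t ^ (r / p) ≤
      ∫⁻ u in Ioo 0 t, ENNReal.ofReal (u ^ (r - 1)) * distribution f μ u ^ (r / p) := by
    refine setLIntegral_mono_ae' measurableSet_Ioo (.of_forall fun u hu => ?_)
    gcongr
    exact antitone_distribution f μ hu.2.le
  rw [lintegral_mul_const _ (by fun_prop), setLIntegral_Ioo_rpow hr ht.le] at h
  calc _ = ENNReal.ofReal r *
        (ENNReal.ofReal t ^ r / ENNReal.ofReal r * distribution f μ t ^ (r / p)) := by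
        rw [← mul_assoc, ENNReal.mul_div_cancel (by simpa using hr) ENNReal.ofReal_ne_top]
    _ ≤ _ := by gcongr

/-- The embedding `L^{p,q} ⊆ L^{p,r}` for `q ≤ r`. -/
lemma eLorentzNorm_le_of_le {α : Type*} [MeasurableSpace α] {p q r : ℝ} (hp : 0 < p) (hq : 0 < q)
    (hqr : q ≤ r) : ∃ C : ℝ≥0∞, C ≠ ∞ ∧ ∀ (μ : Measure α) (f : α → ℝ),
      eLorentzNorm f p r μ ≤ C * eLorentzNorm f p q μ := by
  have hr : 0 < r := hq.trans_le hqr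
  refine ⟨((ENNReal.ofReal q / ENNReal.ofReal p) ^ ((r - q) / q)) ^ r⁻¹, ?_, fun μ f => ?_⟩
  · refine ENNReal.rpow_ne_top_of_nonneg (by positivity)
      (ENNReal.rpow_ne_top_of_nonneg (div_nonneg (by linarith) hq.le) ?_)
    exact ENNReal.div_ne_top ENNReal.ofReal_ne_top (by simpa using hp)
  set N := ∫⁻ t, ENNReal.ofReal (t ^ (q - 1)) * distribution f μ t ^ (q / p) ∂halfLine with hN
  have hpt : ∀ t : ℝ, 0 < t → ENNReal.ofReal (t ^ (r - 1)) * distribution f μ t ^ (r / p) ≤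
      (ENNReal.ofReal q * N) ^ ((r - q) / q) *
        (ENNReal.ofReal (t ^ (q - 1)) * distribution f μ t ^ (q / p)) := by
    intro t ht
    have h1 : ENNReal.ofReal t ^ q * distribution f μ t ^ (q / p) ≤ ENNReal.ofReal q * N := by
      refine (rpow_mul_distribution_le f μ hp hq ht).trans ?_
      gcongr
      exact lintegral_mono_set Ioo_subset_Ioi_self
    -- The surplus power `r - q` is split off as a power of `t^q d(t)^{q/p}`, which Chebyshev bounds
    -- uniformly in `t`.
    have h2 : ENNReal.ofReal (t ^ (r - 1)) * distribution f μ t ^ (r / p) =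
        (ENNReal.ofReal t ^ q * distribution f μ t ^ (q / p)) ^ ((r - q) / q) *
        (ENNReal.ofReal (t ^ (q - 1)) * distribution f μ t ^ (q / p)) := by
      have hrq : 0 ≤ (r - q) / q := div_nonneg (by linarith) hq.le
      rw [ENNReal.mul_rpow_of_nonneg _ _ hrq, ← ENNReal.rpow_mul, ← ENNReal.rpow_mul,
        mul_mul_mul_comm, ← ENNReal.rpow_add_of_nonneg _ _ (by positivity) (by positivity),
        ENNReal.ofReal_rpow_of_pos ht, ← ENNReal.ofReal_mul (by positivity), ← Real.rpow_add ht]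
      congr 3
      · field_simp; ring
      · field_simp; ring
    rw [h2]
    gcongr
  have hmain : eLorentzNorm f p r μ ^ r ≤
      (ENNReal.ofReal q / ENNReal.ofReal p) ^ ((r - q) / q) * eLorentzNorm f p q μ ^ r := by
    have hrq : 0 ≤ (r - q) / q := div_nonneg (by linarith) hq.le
    have hp0 : ENNReal.ofReal p ≠ 0 := by simpa using hp
    calc eLorentzNorm f p r μ ^ r ≤ ENNReal.ofReal p * ((ENNReal.ofReal q * N) ^ ((r - q) / q) * N) := by
          rw [eLorentzNorm_rpow _ _ hr]
          gcongr
          refine (lintegral_mono_ae (ae_halfLine_pos.mono hpt)).trans_eq ?_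
          rw [lintegral_const_mul _ (measurable_rpow_mul_distribution _ _ _ _)]
      _ = (ENNReal.ofReal q / ENNReal.ofReal p) ^ ((r - q) / q) *
          ((eLorentzNorm f p q μ ^ q) ^ ((r - q) / q) * eLorentzNorm f p q μ ^ q) := by
          have : ENNReal.ofReal q * N =
              ENNReal.ofReal q / ENNReal.ofReal p * (ENNReal.ofReal p * N) := by
            rw [← mul_assoc, ENNReal.div_mul_cancel hp0 ENNReal.ofReal_ne_top]
          rw [eLorentzNorm_rpow _ _ hq, ← hN, this, ENNReal.mul_rpow_of_nonneg _ _ hrq]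
          ring
      _ = _ := by
          rw [← ENNReal.rpow_mul, ← ENNReal.rpow_add_of_nonneg _ _ (by positivity) hq.le]
          congr 2
          field_simp; ring
  have := ENNReal.rpow_le_rpow hmain (inv_nonneg.2 hr.le)
  rwa [ENNReal.mul_rpow_of_nonneg _ _ (inv_nonneg.2 hr.le), ENNReal.rpow_rpow_inv hr.ne',
    ENNReal.rpow_rpow_inv hr.ne'] at this

/-! ### Boundedness of the Laplace transform -/

/-- Both sides are the area of the part of the subgraph of `d` below height `x`, sliced in the two
directions. -/
lemma lintegral_min_halfLine {d : ℝ → ℝ≥0∞} (hd : Measurable d) (x : ℝ) :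
    ∫⁻ u, min (d u) (ENNReal.ofReal x) ∂halfLine =
      ∫⁻ s in Ioo 0 x, halfLine {u | ENNReal.ofReal s < d u} := by
  have h := lintegral_halfLine_region_swap (hd.min (measurable_const (a := ENNReal.ofReal x)))
    (measurable_const (a := (1 : ℝ≥0∞))) (measurable_const (a := (1 : ℝ≥0∞)))
  simp only [lintegral_const, one_mul, Measure.restrict_apply_univ, halfLine_ofReal_lt] at h
  rw [h, ← halfLine_restrict_ofReal_lt, ← lintegral_indicator
    (measurableSet_lt ENNReal.measurable_ofReal measurable_const)]
  refine lintegral_congr fun s => ?_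
  by_cases hs : ENNReal.ofReal s < ENNReal.ofReal x
  · rw [indicator_of_mem (by exact hs)]
    simp [hs]
  · rw [indicator_of_notMem (by exact hs)]
    simp [hs]

/-- The kernel of the Laplace transform tested on `|f|` is controlled by the distribution of `f`. -/
lemma lintegral_laplace_le {f : ℝ → ℝ} (hf : AEMeasurable f halfLine) {t : ℝ} (ht : 0 < t) :
    ∫⁻ s, ‖f s * Real.exp (-(t * s))‖ₑ ∂halfLine ≤
      ∫⁻ s in Ioo 0 t⁻¹, halfLine {u | ENNReal.ofReal s < distribution f halfLine u} := by
  set w : ℝ → ℝ≥0∞ := fun s => ENNReal.ofReal (Real.exp (-(t * s))) with hw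
  have hwm : Measurable w := by fun_prop
  have hfν : AEMeasurable f (halfLine.withDensity w) :=
    hf.mono_ac (withDensity_absolutelyContinuous _ _)
  have h1 : ∫⁻ s, ‖f s * Real.exp (-(t * s))‖ₑ ∂halfLine =
      ∫⁻ s, ENNReal.ofReal |f s| ∂halfLine.withDensity w := by
    rw [lintegral_withDensity_eq_lintegral_mul₀ hwm.aemeasurable
      (hf.abs.ennreal_ofReal)]
    refine lintegral_congr fun s => ?_
    rw [Pi.mul_apply, hw, ← ENNReal.ofReal_mul (Real.exp_pos _).le, ← Real.enorm_abs, abs_mul,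
      abs_of_pos (Real.exp_pos _), mul_comm, Real.enorm_of_nonneg (by positivity)]
  rw [h1, lintegral_eq_lintegral_meas_lt _ (.of_forall fun s => abs_nonneg _)
    hfν.abs, ← lintegral_min_halfLine (antitone_distribution f _).measurable]
  -- For the measure `e^{-ts} ds`, a superlevel set has at most its Lebesgue measure, as the density
  -- is at most `1`, and at most the total mass `1/t`.
  refine lintegral_mono fun u => le_min ?_ ?_
  · rw [withDensity_apply']
    refine (lintegral_mono_ae (g := fun _ => 1) (ae_restrict_of_ae ?_)).trans_eq
      (by simp [distribution])
    filter_upwards [ae_halfLine_pos] with s hs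
    exact ENNReal.ofReal_le_one.2 (Real.exp_le_one_iff.2 (by nlinarith))
  · refine (measure_mono (subset_univ _)).trans_eq ?_
    have hint := exp_neg_integrableOn_Ioi 0 ht
    rw [withDensity_apply', Measure.restrict_univ, hw, halfLine]
    simp_rw [← neg_mul]
    rw [← ofReal_integral_eq_lintegral_ofReal hint (.of_forall fun s => (Real.exp_pos _).le),
      integral_exp_mul_Ioi (by linarith)]
    simp [neg_div_neg_eq]

/-- A weighted Hardy inequality. -/
lemma exists_hardy {q θ : ℝ} (hq : 1 < q) (hθ : θ < 1) :
    ∃ C : ℝ≥0∞, C ≠ ∞ ∧ ∀ F : ℝ → ℝ≥0∞, Measurable F →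
      ∫⁻ t, ENNReal.ofReal (t ^ (q * (1 - θ) - 1)) * (∫⁻ s in Ioo 0 t⁻¹, F s) ^ q ∂halfLine ≤
        C * ∫⁻ s, ENNReal.ofReal (s ^ (q * θ - 1)) * F s ^ q ∂halfLine := by
  have hq0 : 0 < q := by linarith
  -- Hölder is applied with the weight `s^a`. Integrability of the dual weight at `0` needs `a < 1 -
  -- 1/q`, and that of the outer power of `t` after Fubini needs `a > θ - 1/q`; `a` is the midpoint.
  set a := (θ + 1) / 2 - 1 / q with ha
  set c := 1 - a * (q / (q - 1)) with hc
  set e := q * (1 - θ) / 2 with he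
  have haq : a * q = q * (θ + 1) / 2 - 1 := by rw [ha]; field_simp
  have hc' : c * (q - 1) = e := by
    have : q - 1 ≠ 0 := by linarith
    have : c * (q - 1) = q - 1 - a * q := by rw [hc]; field_simp
    rw [this, haq, he]; ring
  have he0 : 0 < e := by have : 0 < q * (1 - θ) := mul_pos hq0 (by linarith)
                         positivity
  have hc0 : 0 < c := pos_of_mul_pos_left (hc' ▸ he0) (by linarith)
  refine ⟨(ENNReal.ofReal c)⁻¹ ^ (q - 1) * (ENNReal.ofReal e)⁻¹, ?_, fun F hF => ?_⟩
  · refine ENNReal.mul_ne_top (ENNReal.rpow_ne_top_of_nonneg (by linarith) ?_) ?_ <;> simpa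
  have holder : ∀ x : ℝ, 0 < x → (∫⁻ s in Ioo 0 x, F s) ^ q ≤
      (ENNReal.ofReal c)⁻¹ ^ (q - 1) * (ENNReal.ofReal (x ^ e) *
        ∫⁻ s in Ioo 0 x, F s ^ q * ENNReal.ofReal (s ^ (a * q))) := by
    intro x hx
    have hpq : q.HolderConjugate (q / (q - 1)) := Real.HolderConjugate.conjExponent hq
    have h := ENNReal.lintegral_mul_le_Lp_mul_Lq (volume.restrict (Ioo 0 x)) hpq
      (f := fun s => F s * ENNReal.ofReal (s ^ a)) (g := fun s => ENNReal.ofReal (s ^ (-a)))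
      (by fun_prop) (by fun_prop)
    have e1 : ∫⁻ s in Ioo 0 x, ((fun s => F s * ENNReal.ofReal (s ^ a)) *
        fun s => ENNReal.ofReal (s ^ (-a))) s = ∫⁻ s in Ioo 0 x, F s := by
      refine setLIntegral_congr_fun measurableSet_Ioo fun s hs => ?_
      have hs0 : 0 < s := hs.1
      simp only [Pi.mul_apply]
      rw [mul_assoc, ← ENNReal.ofReal_mul (by positivity), ← Real.rpow_add hs0]
      simp
    have e2 : ∫⁻ s in Ioo 0 x, (F s * ENNReal.ofReal (s ^ a)) ^ q =
        ∫⁻ s in Ioo 0 x, F s ^ q * ENNReal.ofReal (s ^ (a * q)) := by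
      refine setLIntegral_congr_fun measurableSet_Ioo fun s hs => ?_
      have hs0 : 0 < s := hs.1
      rw [ENNReal.mul_rpow_of_nonneg _ _ hq0.le, ENNReal.ofReal_rpow_of_pos (by positivity),
        ← Real.rpow_mul hs0.le]
    have e3 : ∫⁻ s in Ioo 0 x, ENNReal.ofReal (s ^ (-a)) ^ (q / (q - 1)) =
        ENNReal.ofReal x ^ c / ENNReal.ofReal c := by
      rw [← setLIntegral_Ioo_rpow hc0 hx.le]
      refine setLIntegral_congr_fun measurableSet_Ioo fun s hs => ?_
      have hs0 : 0 < s := hs.1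
      rw [ENNReal.ofReal_rpow_of_pos (by positivity), ← Real.rpow_mul hs0.le]
      congr 2
      rw [hc]; ring
    rw [e1, e2, e3] at h
    have h' := ENNReal.rpow_le_rpow h hq0.le
    refine h'.trans_eq ?_
    have hq1 : 1 / (q / (q - 1)) * q = q - 1 := by field_simp
    rw [ENNReal.mul_rpow_of_nonneg _ _ hq0.le, ← ENNReal.rpow_mul, ← ENNReal.rpow_mul,
      one_div_mul_cancel hq0.ne', ENNReal.rpow_one, hq1, div_eq_mul_inv,
      ENNReal.mul_rpow_of_nonneg _ _ (by linarith), ← ENNReal.rpow_mul, hc',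
      ENNReal.ofReal_rpow_of_pos hx]
    ring
  have hstep : ∀ t : ℝ, 0 < t →
      ENNReal.ofReal (t ^ (q * (1 - θ) - 1)) * (∫⁻ s in Ioo 0 t⁻¹, F s) ^ q ≤
      (ENNReal.ofReal c)⁻¹ ^ (q - 1) * (ENNReal.ofReal (t ^ (e - 1)) *
        ∫⁻ s in {s | ENNReal.ofReal s < ENNReal.ofReal t⁻¹},
          F s ^ q * ENNReal.ofReal (s ^ (a * q)) ∂halfLine) := by
    intro t ht
    have hpow : ENNReal.ofReal (t ^ (e - 1)) =
        ENNReal.ofReal (t ^ (q * (1 - θ) - 1)) * ENNReal.ofReal (t⁻¹ ^ e) := by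
      rw [← ENNReal.ofReal_mul (by positivity), Real.inv_rpow ht.le, ← Real.rpow_neg ht.le,
        ← Real.rpow_add ht]
      congr 2
      rw [he]; ring
    rw [halfLine_restrict_ofReal_lt, hpow]
    refine (mul_le_mul_right (holder t⁻¹ (inv_pos.2 ht)) _).trans_eq ?_
    simp only [mul_assoc, mul_left_comm]
  have hcm : (ENNReal.ofReal c)⁻¹ ^ (q - 1) ≠ ∞ :=
    ENNReal.rpow_ne_top_of_nonneg (by linarith) (by simpa)
  refine (lintegral_mono_ae (ae_halfLine_pos.mono hstep)).trans ?_
  rw [lintegral_const_mul' _ _ hcm, mul_assoc]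
  gcongr
  -- By Fubini the inner integral becomes that of `t^{e-1}` over `t < 1/s`, namely `s^{-e}/e`, and
  -- `a q - e = q θ - 1` restores the desired weight.
  rw [lintegral_halfLine_region_swap (by fun_prop) (by fun_prop) (by fun_prop),
    ← lintegral_const_mul' _ _ (by simpa)]
  refine (lintegral_congr_ae ?_).le
  filter_upwards [ae_halfLine_pos] with s hs
  have hset : halfLine.restrict {u | ENNReal.ofReal s < ENNReal.ofReal u⁻¹} =
      halfLine.restrict {u | ENNReal.ofReal u < ENNReal.ofReal s⁻¹} := by
    refine Measure.restrict_congr_set ?_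
    filter_upwards [ae_halfLine_pos] with u hu
    refine propext ?_
    change ENNReal.ofReal s < ENNReal.ofReal u⁻¹ ↔ ENNReal.ofReal u < ENNReal.ofReal s⁻¹
    rw [ENNReal.ofReal_lt_ofReal_iff_of_nonneg hs.le, ENNReal.ofReal_lt_ofReal_iff_of_nonneg hu.le,
      lt_inv_comm₀ hs hu]
  rw [hset, setLIntegral_halfLine_rpow he0, ENNReal.ofReal_rpow_of_pos (inv_pos.2 hs),
    ENNReal.div_eq_inv_mul]
  have hpow : ENNReal.ofReal (s ^ (q * θ - 1)) =
      ENNReal.ofReal (s ^ (a * q)) * ENNReal.ofReal (s⁻¹ ^ e) := by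
    rw [← ENNReal.ofReal_mul (by positivity), Real.inv_rpow hs.le, ← Real.rpow_neg hs.le,
      ← Real.rpow_add hs]
    congr 2
    rw [he, haq]; ring
  rw [hpow]
  ring

/-- The operator majorising the Laplace transform. -/
noncomputable def laplaceMajorant (f : ℝ → ℝ) (t : ℝ) : ℝ≥0∞ :=
  ∫⁻ s in Ioo 0 t⁻¹, halfLine {u | ENNReal.ofReal s < distribution f halfLine u}

lemma laplaceMajorant_le_of_le (f : ℝ → ℝ) {s t : ℝ} (hs : 0 < s) (hst : s ≤ t) :
    laplaceMajorant f t ≤ laplaceMajorant f s :=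
  lintegral_mono_set (Ioo_subset_Ioo_right (inv_anti₀ hs hst))

lemma exists_laplaceMajorant_bound {p q : ℝ} (hp : 1 < p) (hq : 1 < q) :
    ∃ C : ℝ≥0∞, C ≠ ∞ ∧ ∀ f : ℝ → ℝ,
      ∫⁻ t, ENNReal.ofReal (t ^ (q / (p / (p - 1)) - 1)) * laplaceMajorant f t ^ q ∂halfLine ≤
        C * eLorentzNorm f p q halfLine ^ q := by
  obtain ⟨C, hC, h⟩ := exists_hardy hq (θ := 1 / p) ((div_lt_one (by linarith)).2 hp)
  refine ⟨C, hC, fun f => ?_⟩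
  have e : q / (p / (p - 1)) = q * (1 - 1 / p) := by field_simp
  have e' : q / p = q * (1 / p) := by ring
  rw [eLorentzNorm_rpow _ _ (by linarith), lintegral_rpow_mul_antitone
    (antitone_distribution f halfLine) (by linarith) (by linarith), e, e']
  exact h _ (antitone_halfLine_lt _).measurable

/-- By monotonicity, an infinite value at `t` would force the value `∞` on all of `(0,t)`, making
the weighted integral in the Hardy bound infinite. -/
lemma laplaceMajorant_lt_top {p q : ℝ} (hp : 1 < p) (hq : 1 < q) {f : ℝ → ℝ}
    (hf : eLorentzNorm f p q halfLine < ∞) {t : ℝ} (ht : 0 < t) : laplaceMajorant f t < ∞ := by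
  obtain ⟨C, hC, h⟩ := exists_laplaceMajorant_bound hp hq
  have hfin := (h f).trans_lt (ENNReal.mul_lt_top hC.lt_top
    (ENNReal.rpow_lt_top_of_nonneg (by linarith) hf.ne))
  by_contra htop
  rw [not_lt, top_le_iff] at htop
  refine hfin.ne (top_le_iff.1 ?_)
  have hpos : 0 < q / (p / (p - 1)) := div_pos (by linarith) (div_pos (by linarith) (by linarith))
  calc ∞ = ∫⁻ s in Ioo 0 t, ENNReal.ofReal (s ^ (q / (p / (p - 1)) - 1)) * ∞ := by
        rw [lintegral_mul_const _ (by fun_prop), setLIntegral_Ioo_rpow hpos ht.le, ENNReal.mul_top]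
        refine (ENNReal.div_pos (ENNReal.rpow_pos (by simpa) ENNReal.ofReal_ne_top).ne'
          ENNReal.ofReal_ne_top).ne'
    _ ≤ ∫⁻ s in Ioo 0 t, ENNReal.ofReal (s ^ (q / (p / (p - 1)) - 1)) * laplaceMajorant f s ^ q := by
        refine setLIntegral_mono_ae' measurableSet_Ioo (.of_forall fun s hs => ?_)
        have : laplaceMajorant f s = ∞ :=
          top_le_iff.1 (htop ▸ laplaceMajorant_le_of_le f hs.1 hs.2.le)
        rw [this, ENNReal.top_rpow_of_pos (by linarith)]
    _ ≤ _ := lintegral_mono_set Ioo_subset_Ioi_self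

lemma integrable_laplace {p q : ℝ} (hp : 1 < p) (hq : 1 < q) {f : ℝ → ℝ}
    (hf : MemLorentz f p q halfLine) {t : ℝ} (ht : 0 < t) :
    Integrable (fun s => f s * Real.exp (-(t * s))) halfLine :=
  ⟨hf.1.mul (by fun_prop), (lintegral_laplace_le hf.1.aemeasurable ht).trans_lt
    (laplaceMajorant_lt_top hp hq hf.2 ht)⟩

lemma enorm_laplaceTransform_le {f : ℝ → ℝ} (hf : AEMeasurable f halfLine) {t : ℝ} (ht : 0 < t) :
    ‖laplaceTransform f t‖ₑ ≤ laplaceMajorant f t :=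
  (enorm_integral_le_lintegral_enorm _).trans (lintegral_laplace_le hf ht)

/-- A function dominated by a nonincreasing one is estimated by a weighted Lebesgue norm. -/
lemma eLorentzNorm_rpow_le_of_antitoneOn {g : ℝ → ℝ} {G : ℝ → ℝ≥0∞} (hG : AntitoneOn G (Ioi 0))
    (hgG : ∀ t, 0 < t → ‖g t‖ₑ ≤ G t) {a b : ℝ} (ha : 0 < a) (hb : 0 < b) :
    eLorentzNorm g a b halfLine ^ b ≤
      ∫⁻ t, ENNReal.ofReal (t ^ (b / a - 1)) * G t ^ b ∂halfLine := by
  rw [eLorentzNorm_rpow _ _ hb, lintegral_rpow_mul_antitone (antitone_distribution g _) ha hb]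
  refine lintegral_mono_ae ?_
  filter_upwards [ae_halfLine_pos] with t ht
  gcongr
  -- It remains to bound the generalised inverse at `t` by `G t`: if `v ≥ G t`, then `|g| > v` can
  -- only occur on `(0,t)`, so the distribution of `g` at `v` is at most `t`.
  rw [← halfLine_ofReal_lt (G t)]
  refine measure_mono_ae ?_
  filter_upwards [ae_halfLine_pos] with v hv h
  change ENNReal.ofReal v < G t
  by_contra hle
  refine absurd (show ENNReal.ofReal t < distribution g halfLine v from h) (not_lt.2 ?_)
  rw [← halfLine_ofReal_lt (ENNReal.ofReal t)]
  refine measure_mono_ae ?_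
  filter_upwards [ae_halfLine_pos] with s hs hsv
  change ENNReal.ofReal s < ENNReal.ofReal t
  rw [ENNReal.ofReal_lt_ofReal_iff ht]
  by_contra hts
  refine hle (lt_of_lt_of_le ?_ ((hgG s hs).trans (hG ht hs (not_lt.1 hts))))
  rw [← Real.enorm_abs, Real.enorm_of_nonneg (abs_nonneg _)]
  exact (ENNReal.ofReal_lt_ofReal_iff_of_nonneg hv.le).2 hsv

/-- The Hardy estimate gives the bound with second index `q` on the target; the embedding then
raises it to `r`. -/
lemma exists_laplaceTransform_bound {p q r : ℝ} (hp : 1 < p) (hq : 1 < q) (hqr : q ≤ r) :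
    ∃ C : ℝ≥0∞, C ≠ ∞ ∧ ∀ f : ℝ → ℝ, AEMeasurable f halfLine →
      eLorentzNorm (laplaceTransform f) (p / (p - 1)) r halfLine ≤
        C * eLorentzNorm f p q halfLine := by
  have hq0 : 0 < q := by linarith
  have hp' : 0 < p / (p - 1) := div_pos (by linarith) (by linarith)
  obtain ⟨C, hC, h⟩ := exists_laplaceMajorant_bound hp hq
  obtain ⟨D, hD, h'⟩ := eLorentzNorm_le_of_le (α := ℝ) hp' hq0 hqr
  refine ⟨D * C ^ q⁻¹, ENNReal.mul_ne_top hD (ENNReal.rpow_ne_top_of_nonneg (by positivity) hC),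
    fun f hf => (h' _ _).trans ?_⟩
  rw [mul_assoc]
  gcongr
  have h1 := (eLorentzNorm_rpow_le_of_antitoneOn (G := laplaceMajorant f)
    (fun s hs t _ hst => laplaceMajorant_le_of_le f hs hst)
    (fun t ht => enorm_laplaceTransform_le hf ht) hp' hq0).trans (h f)
  have h2 := ENNReal.rpow_le_rpow h1 (inv_nonneg.2 hq0.le)
  rwa [ENNReal.mul_rpow_of_nonneg _ _ (inv_nonneg.2 hq0.le), ENNReal.rpow_rpow_inv hq0.ne',
    ENNReal.rpow_rpow_inv hq0.ne'] at h2

lemma aestronglyMeasurable_laplaceTransform {f : ℝ → ℝ} (hf : AEStronglyMeasurable f halfLine) :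
    AEStronglyMeasurable (laplaceTransform f) halfLine := by
  have : AEStronglyMeasurable (fun z : ℝ × ℝ => f z.2 * Real.exp (-(z.1 * z.2)))
      (halfLine.prod halfLine) := hf.comp_snd.mul (by fun_prop)
  exact this.integral_prod_right'

/-! ### Isometric dilations and their interaction with the Laplace transform -/

/-- The dilation `f ↦ k^{1/p} f(k ·)`. -/
noncomputable def lorentzDilation (p k : ℝ) (f : ℝ → ℝ) (x : ℝ) : ℝ := k ^ (1 / p) * f (k * x)

lemma map_mul_left_halfLine {k : ℝ} (hk : 0 < k) :
    halfLine.map (MeasurableEquiv.mulLeft₀ k hk.ne') = ENNReal.ofReal k⁻¹ • halfLine := by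
  have h : (Ioi 0 : Set ℝ) = MeasurableEquiv.mulLeft₀ k hk.ne' ⁻¹' Ioi 0 := by
    ext x
    simp [hk]
  rw [halfLine]
  conv_lhs => rw [h]
  rw [← MeasurableEquiv.restrict_map, MeasurableEquiv.coe_mulLeft₀, Real.map_volume_mul_left hk.ne',
    Measure.restrict_smul, abs_of_pos (inv_pos.2 hk)]

lemma halfLine_preimage_mul_left {k : ℝ} (hk : 0 < k) (s : Set ℝ) :
    halfLine ((k * ·) ⁻¹' s) = ENNReal.ofReal k⁻¹ * halfLine s := by
  have h := MeasurableEquiv.map_apply (μ := halfLine) (MeasurableEquiv.mulLeft₀ k hk.ne') s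
  rw [map_mul_left_halfLine hk] at h
  exact h.symm

lemma lintegral_halfLine_comp_mul_left {k : ℝ} (hk : 0 < k) (F : ℝ → ℝ≥0∞) :
    ∫⁻ x, F (k * x) ∂halfLine = ENNReal.ofReal k⁻¹ * ∫⁻ x, F x ∂halfLine := by
  have := lintegral_map_equiv (μ := halfLine) F (MeasurableEquiv.mulLeft₀ k hk.ne')
  rw [map_mul_left_halfLine hk, lintegral_smul_measure] at this
  exact this.symm

lemma distribution_lorentzDilation (p : ℝ) {k : ℝ} (hk : 0 < k) (f : ℝ → ℝ) (t : ℝ) :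
    distribution (lorentzDilation p k f) halfLine t =
      ENNReal.ofReal k⁻¹ * distribution f halfLine ((k ^ (1 / p))⁻¹ * t) := by
  rw [distribution, distribution, ← halfLine_preimage_mul_left hk]
  congr 1
  ext x
  have hkp : 0 < k ^ (1 / p) := Real.rpow_pos_of_pos hk _
  rw [mem_preimage, mem_ofPred_eq, mem_ofPred_eq, lorentzDilation, abs_mul, abs_of_pos hkp,
    inv_mul_lt_iff₀ hkp]

lemma eLorentzNorm_lorentzDilation {p r k : ℝ} (hp : 0 < p) (hr : 0 < r) (hk : 0 < k)
    (f : ℝ → ℝ) :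
    eLorentzNorm (lorentzDilation p k f) p r halfLine = eLorentzNorm f p r halfLine := by
  have hkp : 0 < k ^ (1 / p) := Real.rpow_pos_of_pos hk _
  have h : eLorentzNorm (lorentzDilation p k f) p r halfLine ^ r =
      eLorentzNorm f p r halfLine ^ r := by
    rw [eLorentzNorm_rpow _ _ hr, eLorentzNorm_rpow _ _ hr]
    congr 1
    set F : ℝ → ℝ≥0∞ := fun t => ENNReal.ofReal (t ^ (r - 1)) * distribution f halfLine t ^ (r / p)
    have h1 : ∀ t : ℝ, 0 < t →
        ENNReal.ofReal (t ^ (r - 1)) *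
          distribution (lorentzDilation p k f) halfLine t ^ (r / p) =
        ENNReal.ofReal (k ^ (1 / p))⁻¹ * F ((k ^ (1 / p))⁻¹ * t) := by
      intro t ht
      have hk' : (k ^ (1 / p))⁻¹ = k⁻¹ ^ (1 / p) := (Real.inv_rpow hk.le _).symm
      have hki : 0 < k⁻¹ := inv_pos.2 hk
      rw [distribution_lorentzDilation p hk, ENNReal.mul_rpow_of_nonneg _ _ (by positivity),
        ENNReal.ofReal_rpow_of_pos hki, ← mul_assoc, ← ENNReal.ofReal_mul (by positivity)]
      simp only [F]
      rw [← mul_assoc, ← ENNReal.ofReal_mul (by positivity)]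
      congr 2
      rw [hk', Real.mul_rpow (by positivity) ht.le, ← Real.rpow_mul hki.le, ← mul_assoc,
        ← Real.rpow_add hki, mul_comm]
      congr 2
      ring
    rw [lintegral_congr_ae (ae_halfLine_pos.mono h1),
      lintegral_const_mul' _ _ ENNReal.ofReal_ne_top,
      lintegral_halfLine_comp_mul_left (inv_pos.2 hkp), ← mul_assoc, inv_inv,
      ← ENNReal.ofReal_mul (by positivity), inv_mul_cancel₀ hkp.ne', ENNReal.ofReal_one, one_mul]
  exact ENNReal.rpow_left_injective hr.ne' h

lemma memLorentz_lorentzDilation {p r k : ℝ} (hp : 0 < p) (hr : 0 < r) (hk : 0 < k) {f : ℝ → ℝ}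
    (hf : MemLorentz f p r halfLine) : MemLorentz (lorentzDilation p k f) p r halfLine := by
  refine ⟨?_, by rw [eLorentzNorm_lorentzDilation hp hr hk]; exact hf.2⟩
  have hq : Measure.QuasiMeasurePreserving (k * ·) halfLine halfLine := by
    refine ⟨by fun_prop, ?_⟩
    have := map_mul_left_halfLine hk
    rw [MeasurableEquiv.coe_mulLeft₀] at this
    rw [this]
    exact Measure.smul_absolutelyContinuous
  exact (hf.1.comp_quasiMeasurePreserving hq).const_mul _

lemma lorentzDilation_sub (p k : ℝ) (f g : ℝ → ℝ) :
    lorentzDilation p k (f - g) = lorentzDilation p k f - lorentzDilation p k g := by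
  ext x
  simp [lorentzDilation, mul_sub]

lemma lorentzDilation_inv_lorentzDilation (p : ℝ) {k : ℝ} (hk : 0 < k) (f : ℝ → ℝ) :
    lorentzDilation p k⁻¹ (lorentzDilation p k f) = f := by
  ext x
  simp only [lorentzDilation]
  rw [← mul_assoc, ← Real.mul_rpow (inv_pos.2 hk).le hk.le, inv_mul_cancel₀ hk.ne', Real.one_rpow,
    mul_inv_cancel_left₀ hk.ne', one_mul]

/-- Substituting `s ↦ k s` produces the factor `k^{1/p - 1} = (1/k)^{1/p'}`, exactly the
normalisation for the conjugate exponent. -/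
lemma laplaceTransform_lorentzDilation {p k : ℝ} (hp : 1 < p) (hk : 0 < k) (f : ℝ → ℝ) :
    laplaceTransform (lorentzDilation p k f) =
      lorentzDilation (p / (p - 1)) k⁻¹ (laplaceTransform f) := by
  ext t
  have h := integral_comp_mul_left_Ioi (fun s => f s * Real.exp (-(k⁻¹ * t * s))) 0 hk
  rw [mul_zero] at h
  have e : ∀ s, lorentzDilation p k f s * Real.exp (-(t * s)) =
      k ^ (1 / p) * (f (k * s) * Real.exp (-(k⁻¹ * t * (k * s)))) := fun s => by
    rw [lorentzDilation, mul_assoc]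
    congr 4
    field_simp
  simp only [lorentzDilation, laplaceTransform, halfLine]
  have e' := integral_congr_ae (μ := volume.restrict (Ioi 0)) (Filter.Eventually.of_forall e)
  simp only [lorentzDilation] at e'
  rw [e', integral_const_mul, h, smul_eq_mul, ← mul_assoc]
  congr 1
  rw [Real.inv_rpow hk.le, ← Real.rpow_neg hk.le, ← Real.rpow_neg_one, ← Real.rpow_add hk]
  congr 1
  field_simp
  ring

/-! ### Convergence to zero in measure and the Fatou property -/

open Filter Topology

/-- Scaling turns the level `ε` into a level `τ n → 0` of `h`. Chebyshev bounds `τ^r d_h(τ)^{r/p}`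
by the part of a convergent integral over `(0,τ)`, which vanishes in the limit. -/
lemma tendsto_distribution_lorentzDilation {p r : ℝ} (hp : 0 < p) (hr : 0 < r) {h : ℝ → ℝ}
    (hh : MemLorentz h p r halfLine) {ε : ℝ} (hε : 0 < ε) :
    Tendsto (fun n : ℕ => distribution (lorentzDilation p (n + 1) h) halfLine ε) atTop (𝓝 0) := by
  set I : ℝ → ℝ≥0∞ := fun t =>
    ∫⁻ u in Ioo 0 t, ENNReal.ofReal (u ^ (r - 1)) * distribution h halfLine u ^ (r / p)
  set τ : ℕ → ℝ := fun n => (((n : ℝ) + 1) ^ (1 / p))⁻¹ * ε with hτ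
  have hfin : ∫⁻ u, ENNReal.ofReal (u ^ (r - 1)) * distribution h halfLine u ^ (r / p)
      ∂halfLine ≠ ∞ := by
    have h1 := ENNReal.rpow_ne_top_of_nonneg hr.le hh.2.ne
    rw [eLorentzNorm_rpow _ _ hr] at h1
    intro htop
    rw [htop, ENNReal.mul_top (by simpa using hp)] at h1
    exact h1 rfl
  have hτ0 : Tendsto τ atTop (𝓝 0) := by
    have h1 : Tendsto (fun n : ℕ => ((n : ℝ) + 1) ^ (1 / p)) atTop atTop :=
      (tendsto_rpow_atTop (by positivity)).comp
        (tendsto_atTop_add_const_right _ _ tendsto_natCast_atTop_atTop)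
    simpa [hτ] using h1.inv_tendsto_atTop.mul_const ε
  have hI : Tendsto (fun n => I (τ n)) atTop (𝓝 0) := by
    have h1 : Tendsto (fun n => ∫⁻ u in Iio (τ n),
        ENNReal.ofReal (u ^ (r - 1)) * distribution h halfLine u ^ (r / p) ∂halfLine)
        atTop (𝓝 0) := by
      refine tendsto_setLIntegral_zero hfin ?_
      have h2 : ∀ n, halfLine (Iio (τ n)) = ENNReal.ofReal (τ n) := fun n => by
        rw [halfLine, Measure.restrict_apply measurableSet_Iio, inter_comm, Ioi_inter_Iio]
        simp
      refine Tendsto.congr (fun n => (h2 n).symm) ?_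
      simpa using ENNReal.tendsto_ofReal hτ0
    refine h1.congr fun n => ?_
    rw [halfLine, Measure.restrict_restrict measurableSet_Iio, inter_comm, Ioi_inter_Iio]
    rfl
  have hle : ∀ n : ℕ, distribution (lorentzDilation p (n + 1) h) halfLine ε ≤
      (ENNReal.ofReal (ε ^ r)⁻¹ * (ENNReal.ofReal r * I (τ n))) ^ (p / r) := by
    intro n
    have hn : (0 : ℝ) < n + 1 := by positivity
    have hτp : 0 < τ n := by positivity
    have h1 := rpow_mul_distribution_le h halfLine hp hr hτp
    rw [distribution_lorentzDilation p hn]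
    -- By the choice of `τ`, `1/(n+1) = (τ n / ε)^p`, so the dilation factor supplies precisely the
    -- power of `τ` required by Chebyshev.
    have h2 : ENNReal.ofReal ((n : ℝ) + 1)⁻¹ ^ (r / p) =
        ENNReal.ofReal (ε ^ r)⁻¹ * ENNReal.ofReal (τ n) ^ r := by
      rw [ENNReal.ofReal_rpow_of_pos (inv_pos.2 hn), ENNReal.ofReal_rpow_of_pos hτp,
        ← ENNReal.ofReal_mul (by positivity), hτ]
      congr 1
      rw [Real.mul_rpow (by positivity) hε.le, ← Real.inv_rpow hn.le, ← Real.rpow_mul (by positivity),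
        mul_comm (_ ^ _) (ε ^ r), inv_mul_cancel_left₀ (by positivity)]
      congr 1
      ring
    have h3 : (ENNReal.ofReal ((n : ℝ) + 1)⁻¹ * distribution h halfLine (τ n)) ^ (r / p) ≤
        ENNReal.ofReal (ε ^ r)⁻¹ * (ENNReal.ofReal r * I (τ n)) := by
      rw [ENNReal.mul_rpow_of_nonneg _ _ (by positivity), h2, mul_assoc]
      gcongr
    have h4 := ENNReal.rpow_le_rpow h3 (show 0 ≤ p / r by positivity)
    rwa [← ENNReal.rpow_mul, show r / p * (p / r) = 1 by field_simp, ENNReal.rpow_one] at h4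
  refine tendsto_of_tendsto_of_tendsto_of_le_of_le tendsto_const_nhds ?_ (fun _ => zero_le) hle
  have h5 : Tendsto (fun n => ENNReal.ofReal (ε ^ r)⁻¹ * (ENNReal.ofReal r * I (τ n))) atTop
      (𝓝 0) := by
    simpa using ENNReal.Tendsto.const_mul
      (ENNReal.Tendsto.const_mul hI (Or.inr ENNReal.ofReal_ne_top)) (Or.inr ENNReal.ofReal_ne_top)
  simpa [div_pos hp hr] using h5.ennrpow_const (p / r)

lemma distribution_add_le {α : Type*} [MeasurableSpace α] (f g : α → ℝ) (μ : Measure α) (s t : ℝ) :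
    distribution f μ (s + t) ≤ distribution (f - g) μ s + distribution g μ t := by
  refine (measure_mono fun x hx => ?_).trans (measure_union_le _ _)
  by_contra hc
  simp only [mem_union, mem_ofPred_eq, not_or, not_lt, Pi.sub_apply] at hc
  have h1 : s + t < |f x| := hx
  have h2 := abs_add_le (f x - g x) (g x)
  rw [sub_add_cancel] at h2
  linarith [hc.1, hc.2]

/-- The distribution function is lower semicontinuous under convergence in measure. -/
lemma distribution_le_liminf {α : Type*} [MeasurableSpace α] {μ : Measure α} (f : α → ℝ)
    {g : ℕ → α → ℝ}
    (hg : ∀ ε : ℝ, 0 < ε → Tendsto (fun n => distribution (g n) μ ε) atTop (𝓝 0)) (t : ℝ) :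
    distribution f μ t ≤ liminf (fun n => distribution (f - g n) μ t) atTop := by
  -- Strict superlevel sets are exhausted from slightly higher levels; the gap `1/(m+1)` absorbs the
  -- perturbation `g n`.
  have hU : {x | t < |f x|} = ⋃ m : ℕ, {x | t + 1 / ((m : ℝ) + 1) < |f x|} := by
    ext x
    simp only [mem_iUnion, mem_ofPred_eq]
    constructor
    · intro hx
      obtain ⟨m, hm⟩ := exists_nat_one_div_lt (sub_pos.2 hx)
      exact ⟨m, by linarith⟩
    · rintro ⟨m, hm⟩
      have : 0 < 1 / ((m : ℝ) + 1) := by positivity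
      linarith
  have hmono : Monotone fun m : ℕ => {x | t + 1 / ((m : ℝ) + 1) < |f x|} := by
    intro m n hmn x hx
    have : 1 / ((n : ℝ) + 1) ≤ 1 / ((m : ℝ) + 1) := Nat.one_div_le_one_div hmn
    simp only [mem_ofPred_eq] at hx ⊢
    linarith
  rw [distribution, hU, hmono.measure_iUnion]
  refine iSup_le fun m => ?_
  have hε : 0 < 1 / ((m : ℝ) + 1) := by positivity
  rw [← ENNReal.liminf_add_of_right_tendsto_zero (hg _ hε)]
  refine le_liminf_of_le (by isBoundedDefault) (.of_forall fun n => ?_)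
  exact distribution_add_le f (g n) μ t _

/-- The Fatou property of the Lorentz functional with respect to convergence in measure. -/
lemma eLorentzNorm_le_of_tendsto_distribution {α : Type*} [MeasurableSpace α] {μ : Measure α}
    {p r : ℝ} (hp : 0 < p) (hr : 0 < r) (f : α → ℝ) {g : ℕ → α → ℝ}
    (hg : ∀ ε : ℝ, 0 < ε → Tendsto (fun n => distribution (g n) μ ε) atTop (𝓝 0)) {ρ : ℝ≥0∞}
    (hρ : ∀ n, eLorentzNorm (f - g n) p r μ ≤ ρ) : eLorentzNorm f p r μ ≤ ρ := by
  have hp0 : ENNReal.ofReal p ≠ 0 := by simpa using hp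
  have hrp : 0 < r / p := div_pos hr hp
  rw [← ENNReal.rpow_le_rpow_iff hr, eLorentzNorm_rpow _ _ hr, mul_comm,
    ← ENNReal.le_div_iff_mul_le (Or.inl hp0) (Or.inl ENNReal.ofReal_ne_top)]
  calc _ ≤ ∫⁻ t, liminf (fun n => ENNReal.ofReal (t ^ (r - 1)) *
          distribution (f - g n) μ t ^ (r / p)) atTop ∂halfLine := by
        refine lintegral_mono fun t => ?_
        have hcont : Continuous fun x : ℝ≥0∞ => ENNReal.ofReal (t ^ (r - 1)) * x ^ (r / p) :=
          (ENNReal.continuous_const_mul ENNReal.ofReal_ne_top).comp ENNReal.continuous_rpow_const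
        have hmono : Monotone fun x : ℝ≥0∞ => ENNReal.ofReal (t ^ (r - 1)) * x ^ (r / p) :=
          fun x y hxy => by dsimp only; gcongr
        have := hmono.map_liminf_of_continuousAt (F := atTop)
          (fun n => distribution (f - g n) μ t) hcont.continuousAt
        refine (hmono (distribution_le_liminf f hg t)).trans_eq ?_
        exact this
    _ ≤ liminf (fun n => ∫⁻ t, ENNReal.ofReal (t ^ (r - 1)) *
          distribution (f - g n) μ t ^ (r / p) ∂halfLine) atTop :=
        lintegral_liminf_le fun n => measurable_rpow_mul_distribution _ _ _ _
    _ ≤ ρ ^ r / ENNReal.ofReal p := by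
        refine liminf_le_of_le (by isBoundedDefault) fun b hb => ?_
        obtain ⟨n, hn⟩ := hb.exists
        refine hn.trans ?_
        rw [ENNReal.le_div_iff_mul_le (Or.inl hp0) (Or.inl ENNReal.ofReal_ne_top), mul_comm,
          ← eLorentzNorm_rpow _ _ hr]
        exact ENNReal.rpow_le_rpow (hρ n) hr.le

/-! ### Measure of non-compactness against operator norm -/

/-- A single ball centred at zero covers the image for any finite radius above the norm. -/
lemma lorentzBallMeasure_le_lorentzOpNorm {α β : Type*} [MeasurableSpace α] [MeasurableSpace β]
    {T : (α → ℝ) → β → ℝ} {p q : ℝ} {μ : Measure α} {s r : ℝ} {ν : Measure β} (hs : 0 < s)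
    (hr : 0 < r) : lorentzBallMeasure T p q μ s r ν ≤ lorentzOpNorm T p q μ s r ν := by
  refine le_of_forall_gt_imp_ge_of_dense fun ρ hρ => ?_
  rcases eq_or_ne ρ ∞ with rfl | hρt
  · exact le_top
  refine sInf_le ⟨zero_le.trans_lt hρ, hρt.lt_top, {0}, finite_singleton _, ?_, fun f hf hf1 => ?_⟩
  · rintro h rfl
    exact ⟨aestronglyMeasurable_zero, by rw [eLorentzNorm_zero ν hs hr]; exact ENNReal.zero_lt_top⟩
  · refine ⟨0, rfl, ?_⟩
    rw [sub_zero]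
    refine le_trans ?_ hρ.le
    exact le_iSup_of_le f (le_iSup_of_le hf (le_iSup_of_le hf1 le_rfl))

theorem mainTheorem7 (p q r : ℝ) (hp : 1 < p) (hq : 1 < q) (hqr : q ≤ r) :
    -- `L` is a well-defined map from `L^{p,q}(0,∞)` to `L^{p',r}(0,∞)`, where `p' = p / (p - 1)`,
    (∀ f : ℝ → ℝ, MemLorentz f p q halfLine →
      (∀ t : ℝ, 0 < t → Integrable (fun s => f s * Real.exp (-(t * s))) halfLine) ∧
      MemLorentz (laplaceTransform f) (p / (p - 1)) r halfLine) ∧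
    -- it is bounded,
    lorentzOpNorm laplaceTransform p q halfLine (p / (p - 1)) r halfLine < ∞ ∧
    -- and it is maximally non-compact.
    lorentzBallMeasure laplaceTransform p q halfLine (p / (p - 1)) r halfLine =
      lorentzOpNorm laplaceTransform p q halfLine (p / (p - 1)) r halfLine := by
  have hp0 : 0 < p := by linarith
  have hq0 : 0 < q := by linarith
  have hr0 : 0 < r := by linarith
  have hp' : 0 < p / (p - 1) := div_pos hp0 (by linarith)
  obtain ⟨C, hC, hbound⟩ := exists_laplaceTransform_bound hp hq hqr
  refine ⟨fun f hf => ⟨fun t ht => integrable_laplace hp hq hf ht,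
    aestronglyMeasurable_laplaceTransform hf.1,
    (hbound f hf.1.aemeasurable).trans_lt (ENNReal.mul_lt_top hC.lt_top hf.2)⟩, ?_,
    (lorentzBallMeasure_le_lorentzOpNorm hp' hr0).antisymm ?_⟩
  · refine lt_of_le_of_lt (iSup_le fun f => iSup_le fun hf => iSup_le fun hf1 => ?_) hC.lt_top
    refine (hbound f hf.1.aemeasurable).trans ?_
    simpa using mul_le_mul_right hf1 C
  · refine le_sInf ?_
    rintro ρ ⟨-, -, S, hS, hSmem, hcov⟩
    refine iSup_le fun f => iSup_le fun hf => iSup_le fun hf1 => ?_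
    have key : ∀ n : ℕ, ∃ h ∈ S, eLorentzNorm (laplaceTransform f -
        lorentzDilation (p / (p - 1)) (n + 1) h) (p / (p - 1)) r halfLine ≤ ρ := by
      intro n
      have hn : (0 : ℝ) < n + 1 := by positivity
      obtain ⟨h, hh, hle⟩ := hcov (lorentzDilation p (n + 1) f)
        (memLorentz_lorentzDilation hp0 hq0 hn hf)
        ((eLorentzNorm_lorentzDilation hp0 hq0 hn f).trans_le hf1)
      refine ⟨h, hh, ?_⟩
      -- Applying the target isometry with factor `n + 1` cancels the inverse dilation on `L f` and
      -- moves it onto the centre.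
      rw [laplaceTransform_lorentzDilation hp hn,
        ← eLorentzNorm_lorentzDilation hp' hr0 hn, lorentzDilation_sub] at hle
      have hinv := lorentzDilation_inv_lorentzDilation (p / (p - 1)) (inv_pos.2 hn)
        (laplaceTransform f)
      rw [inv_inv] at hinv
      rwa [hinv] at hle
    -- Pigeonhole: were each of the finitely many centres eventually unusable, all would fail at one
    -- common `n`.
    have hfreq : ∃ h ∈ S, ∃ᶠ n : ℕ in atTop, eLorentzNorm (laplaceTransform f -
        lorentzDilation (p / (p - 1)) (n + 1) h) (p / (p - 1)) r halfLine ≤ ρ := by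
      by_contra hcon
      simp only [not_exists, not_and, not_frequently] at hcon
      obtain ⟨n, hn⟩ := ((eventually_all_finite hS).2 hcon).exists
      obtain ⟨h, hh, hle⟩ := key n
      exact hn h hh hle
    obtain ⟨h, hh, hfr⟩ := hfreq
    obtain ⟨φ, hφ, hφle⟩ := extraction_of_frequently_atTop hfr
    exact eLorentzNorm_le_of_tendsto_distribution hp' hr0 _ (fun ε hε =>
      (tendsto_distribution_lorentzDilation hp' hr0 (hSmem h hh) hε).comp hφ.tendsto_atTop) hφle
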